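/- **Setting.** Let $\mathbb W$ be a measurable space of environments, $q\in\mathbb N$, and let $\mu_1,\dots,\mu_q:\mathbb W\to\mathbb R$ be predicates. A specification $\varphi$ is built from predicates $\mu_i$ and negated predicates $\neg\mu_i$ by $\wedge$ and $\vee$, with quantitative semantics $\neg\mu_i\mapsto-\mu_i$, $\wedge\mapsto\min$, $\vee\mapsto\max$. Its parse tree $\mathcal T$ has the (negated) predicates as leaves and $\min$, $\max$ as inner nodes, so that $\varphi(w)=\mathcal T(\mu_1(w),\dots,\mu_q(w))$. The system satisfies $\varphi$ in environment $w$ iff $\varphi(w)>0$, and is verified if this holds for all $w\in\mathbb W$. Put $f(w,i)=\mu_i(w)$ on $X=\mathbb W\times\{1,\dots,q\}$. Assume that $f$ lies in the reproducing kernel Hilbert space of a measurable kernel $k$ on $X$ with $k(x,x)\le 1$, with norm at most $B$. In round $n=1,2,\dots$ an environment $w_n$ is selected and the $q$ predicates are measured one after the other, $y_{n,i}=f(w_n,i)+\eta_{n,i}$. Here $w_n$ depends measurably on the information available before round $n$, and $\eta_{n,i}$ is $\sigma$-sub-Gaussian ($\sigma>0$) conditionally on the information available before that measurement: $\mathbb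 E[e^{s\eta_{n,i}}\mid\text{past}]\le e^{s^2\sigma^2/2}$ for all $s\in\mathbb R$. Let $m_{q(n-1)},\sigma_{q(n-1)}$ be the posterior mean and standard deviation of the zero-mean Gaussian process with kernel $k$ and noise variance $\sigma^2$, given the measurements of the first $n-1$ rounds. For finitely many, possibly repeated, inputs with kernel matrix $\mathbf K$, let $I=\tfrac12\log\det(\mathbf I+\sigma^{-2}\mathbf K)$ be the mutual information between the Gaussian process and its noisy measurements there; let $I_{q(n-1)}$ be its value at the inputs of the first $n-1$ rounds, and $\gamma_m$ its supremum over all $m$-tuples of inputs. Let $\delta\in(0,1)$, $$\beta_{qn}^{1/2}=B+\max\{4\sigma,\sqrt2\}\,\sqrt{I_{q(n-1)}+1+\ln(1/\delta)},\qquad C_1=\frac{8}{\log(1+\sigma^{-2})},$$ $$l_i=m_{q(n-1)}(\cdot,i)-\beta_{qn}^{1/2}\sigma_{q(n-1)}(\cdot,i),\qquad u_i=m_{q(n-1)}(\cdot,i)+\beta_{qn}^{1/2}\sigma_{q(n-1)}(\cdot,i).$$ The environment $w_n$ minimizes over $\mathbb W$ the value of the parse tree in which every leaf is replaced by its lower confidence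 bound ($\mu_i$ by $l_i$, and $-\mu_i$ by $-u_i$). Let $\hat w_n$ be a minimizer of $\varphi$ over $\{w_1,\dots,w_n\}$, and let $w^*$ denote a minimizer of $\varphi$ over $\mathbb W$. **Theorem.** Let $\epsilon>0$. With probability greater than $1-\delta$ the following holds jointly for all integers $n\ge n^*\ge1$ such that $$\frac{n^*}{\beta_{qn^*}\,\gamma_{qn^*}}\ \ge\ \frac{C_1}{\epsilon^2}\qquad\bigl(\text{that is, } C_1\,\beta_{qn^*}\gamma_{qn^*}\le\epsilon^2 n^*\bigr):$$ if $\varphi(\hat w_n)>\epsilon$, then $\varphi(w^*)>0$ and $\varphi(w)>0$ for every $w\in\mathbb W$; that is, the closed-loop system satisfies $\varphi$ in every environment in $\mathbb W$ and is verified against all of $\mathbb W$. -/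

import Mathlib

open MeasureTheory
open scoped Matrix

noncomputable section

namespace ActiveTesting

/-! ### Specifications and their quantitative semantics -/

/-- Specifications over the predicates `μ 0, …, μ (q-1)`, with negations in front of predicates
only. Read as a tree this is the parse tree: the leaves are predicates or negated predicates,
conjunctions are `min` nodes and disjunctions are `max` nodes. -/
inductive Spec (q : ℕ) : Type
  | pred (i : Fin q) : Spec q
  | negPred (i : Fin q) : Spec q
  | conj (a b : Spec q) : Spec q
  | disj (a b : Spec q) : Spec q

/-- Quantitative semantics: the value of the specification at given predicate values. -/
def Spec.value {q : ℕ} : Spec q → (Fin q → ℝ) → ℝ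
  | .pred i, v => v i
  | .negPred i, v => -v i
  | .conj a b, v => min (a.value v) (b.value v)
  | .disj a b, v => max (a.value v) (b.value v)

/-- The parse tree evaluated at the pessimistic predictions of its leaves, where `l i ≤ u i` are
the confidence bounds of the `i`-th predicate. The lower bound of the leaf `-μ i` is `-u i`.
For a tree without negated leaves this is the tree evaluated at `l`. -/
def Spec.lower {q : ℕ} : Spec q → (Fin q → ℝ) → (Fin q → ℝ) → ℝ
  | .pred i, l, _ => l i
  | .negPred i, _, u => -u i
  | .conj a b, l, u => min (a.lower l u) (b.lower l u)
  | .disj a b, l, u => max (a.lower l u) (b.lower l u)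

/-! ### Gaussian process regression with kernel `k` and noise variance `v` -/

section GP

variable {X ι : Type*} [Fintype ι] [DecidableEq ι]

/-- Kernel matrix of the points `x`. -/
def kernelMatrix (k : X → X → ℝ) (x : ι → X) : Matrix ι ι ℝ :=
  Matrix.of fun a b => k (x a) (x b)

/-- Posterior mean at `p` given the measurements `y` at the points `x`. -/
def postMean (k : X → X → ℝ) (v : ℝ) (x : ι → X) (y : ι → ℝ) (p : X) : ℝ :=
  (fun a => k p (x a)) ⬝ᵥ ((kernelMatrix k x + v • (1 : Matrix ι ι ℝ))⁻¹ *ᵥ y)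

/-- Posterior variance at `p` given measurements at the points `x`. -/
def postVar (k : X → X → ℝ) (v : ℝ) (x : ι → X) (p : X) : ℝ :=
  k p p - (fun a => k p (x a)) ⬝ᵥ
    ((kernelMatrix k x + v • (1 : Matrix ι ι ℝ))⁻¹ *ᵥ (fun a => k p (x a)))

/-- Posterior standard deviation. -/
def postStd (k : X → X → ℝ) (v : ℝ) (x : ι → X) (p : X) : ℝ :=
  Real.sqrt (postVar k v x p)

/-- Mutual information between the Gaussian process with kernel `k` and its measurements at the
points `x` under Gaussian noise of variance `v`. -/
def mutualInfo (k : X → X → ℝ) (v : ℝ) (x : ι → X) : ℝ :=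
  1 / 2 * Real.log (1 + v⁻¹ • kernelMatrix k x).det

/-- Information capacity: the largest mutual information of `n` measurements, repeated
measurements at a point being allowed. -/
def infoCapacity (k : X → X → ℝ) (v : ℝ) (n : ℕ) : ℝ :=
  ⨆ x : Fin n → X, mutualInfo k v x

end GP

/-! ### The active-testing run -/

/-- The extended inputs `(w j, i)`, `j < n`, measured in the first `n` rounds. -/
def inputs {W : Type*} {q : ℕ} (w : ℕ → W) (n : ℕ) : Fin n × Fin q → W × Fin q :=
  fun a => (w a.1, a.2)

/-- The measurements made in the first `n` rounds. -/
def outputs {q : ℕ} (y : ℕ → Fin q → ℝ) (n : ℕ) : Fin n × Fin q → ℝ :=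
  fun a => y a.1 a.2

/-- The confidence multiplier `β^{1/2}` in use when the measurements made so far carry mutual
information `I`. -/
def betaSqrt (B σ δ I : ℝ) : ℝ :=
  B + max (4 * σ) (Real.sqrt 2) * Real.sqrt (I + 1 + Real.log (1 / δ))

section Run

variable {W : Type*} {q : ℕ}

/-- `β^{1/2}` after `n` rounds, i.e. the multiplier that selects the `(n+1)`-st environment. -/
def roundBetaSqrt (k : W × Fin q → W × Fin q → ℝ) (B σ δ : ℝ) (w : ℕ → W) (n : ℕ) : ℝ :=
  betaSqrt B σ δ (mutualInfo k (σ ^ 2) (inputs (q := q) w n))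

/-- Lower confidence bound of the predicate `i` at `e` after `n` rounds. -/
def lcb (k : W × Fin q → W × Fin q → ℝ) (B σ δ : ℝ) (w : ℕ → W) (y : ℕ → Fin q → ℝ) (n : ℕ)
    (e : W) (i : Fin q) : ℝ :=
  postMean k (σ ^ 2) (inputs w n) (outputs y n) (e, i)
    - roundBetaSqrt k B σ δ w n * postStd k (σ ^ 2) (inputs w n) (e, i)

/-- Upper confidence bound of the predicate `i` at `e` after `n` rounds. -/
def ucb (k : W × Fin q → W × Fin q → ℝ) (B σ δ : ℝ) (w : ℕ → W) (y : ℕ → Fin q → ℝ) (n : ℕ)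
    (e : W) (i : Fin q) : ℝ :=
  postMean k (σ ^ 2) (inputs w n) (outputs y n) (e, i)
    + roundBetaSqrt k B σ δ w n * postStd k (σ ^ 2) (inputs w n) (e, i)

/-- The acquisition function after `n` rounds: the pessimistic value of the parse tree. -/
def acquisition (φ : Spec q) (k : W × Fin q → W × Fin q → ℝ) (B σ δ : ℝ) (w : ℕ → W)
    (y : ℕ → Fin q → ℝ) (n : ℕ) (e : W) : ℝ :=
  φ.lower (lcb k B σ δ w y n e) (ucb k B σ δ w y n e)

/-- `e` is a best (that is, `g`-minimizing) environment among the first `n` sampled ones. -/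
def IsBestSample (g : W → ℝ) (w : ℕ → W) (n : ℕ) (e : W) : Prop :=
  (∃ j < n, e = w j) ∧ ∀ j < n, g e ≤ g (w j)

end Run

/-- The real-valued kernel of a reproducing kernel Hilbert space of real functions. -/
def kern (H : Type*) {X : Type*} [NormedAddCommGroup H] [InnerProductSpace ℝ H] [CompleteSpace H]
    [RKHS ℝ H X ℝ] (x x' : X) : ℝ :=
  RKHS.kernel H x x' 1

/-- `ξ` is `σ`-sub-Gaussian conditionally on `m`. -/
def CondSubGaussian {Ω : Type*} [MeasurableSpace Ω] (P : Measure Ω) (m : MeasurableSpace Ω)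
    (σ : ℝ) (ξ : Ω → ℝ) : Prop :=
  ∀ s : ℝ, Integrable (fun ω => Real.exp (s * ξ ω)) P ∧
    P[fun ω => Real.exp (s * ξ ω) | m] ≤ᵐ[P] fun _ => Real.exp (s ^ 2 * σ ^ 2 / 2)

end ActiveTesting

end

set_option linter.unusedSectionVars false

/-! The argument separates one random event from a deterministic analysis of the run. The event says
that the noise ratio `exp((v⁻¹‖e‖² - eᵀA⁻¹e)/2 - I)`, with `A = K + vI` and `v = σ²`, stays below
`exp 1 / δ` at all times. By block elimination the ratio is a product of one-step Gaussian mixture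
likelihood ratios (`noiseRatio_extend`), each of conditional mean at most 1 under sub-Gaussian
noise. It is thus a nonnegative supermartingale started at 1, and Ville's inequality bounds the
failure probability by `δ / exp 1 < δ`. On the event, a weighted Cauchy-Schwarz argument in the RKHS
(`abs_sub_postMean_le`) makes all confidence bounds valid simultaneously.

Given valid bounds, suppose `φ(e) ≤ 0` for some `e` although the best sample exceeds `ε`. Each
selected environment has pessimistic value at most 0 but true value above `ε`, so one of its
predicates has confidence width above `ε`. Hence `ε² < 4 β² σ_j²` for one posterior variance in each
of the first `N` rounds. These variances sum to at most `2γ / log(1 + σ⁻²)` by the chain rule for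
information (`sum_postVar_le`), which contradicts the budget (`value_pos_of_confidence`). -/

namespace ActiveTesting

open scoped RealInnerProductSpace ENNReal Topology

/-! ### Gaussian process regression: one-point updates, information, deterministic error bound. -/

section Regression

variable {X ι κ : Type*} [Fintype ι] [DecidableEq ι] [Fintype κ] [DecidableEq κ]

/-- Regularized kernel matrix. -/
def regMatrix (k : X → X → ℝ) (v : ℝ) (x : ι → X) : Matrix ι ι ℝ :=
  kernelMatrix k x + v • (1 : Matrix ι ι ℝ)

/-- Mahalanobis energy of the data `y` at the points `x`. -/
noncomputable def dataEnergy (k : X → X → ℝ) (v : ℝ) (x : ι → X) (y : ι → ℝ) : ℝ :=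
  y ⬝ᵥ ((regMatrix k v x)⁻¹ *ᵥ y)

lemma postMean_eq (k : X → X → ℝ) (v : ℝ) (x : ι → X) (y : ι → ℝ) (p : X) :
    postMean k v x y p = (fun a => k p (x a)) ⬝ᵥ ((regMatrix k v x)⁻¹ *ᵥ y) := rfl

lemma postVar_eq (k : X → X → ℝ) (v : ℝ) (x : ι → X) (p : X) :
    postVar k v x p = k p p - (fun a => k p (x a)) ⬝ᵥ
      ((regMatrix k v x)⁻¹ *ᵥ (fun a => k p (x a))) := rfl

lemma regMatrix_comp_equiv (k : X → X → ℝ) (v : ℝ) (x : ι → X) (e : κ ≃ ι) :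
    regMatrix k v (x ∘ e) = (regMatrix k v x).submatrix e e := by
  ext a b
  simp [regMatrix, kernelMatrix, Matrix.one_apply]

lemma dataEnergy_comp_equiv (k : X → X → ℝ) (v : ℝ) (x : ι → X) (y : ι → ℝ) (e : κ ≃ ι) :
    dataEnergy k v (x ∘ e) (y ∘ e) = dataEnergy k v x y := by
  unfold dataEnergy
  rw [regMatrix_comp_equiv, Matrix.inv_submatrix_equiv, Matrix.submatrix_mulVec_equiv]
  simp [Function.comp_assoc]

lemma mutualInfo_comp_equiv (k : X → X → ℝ) (v : ℝ) (x : ι → X) (e : κ ≃ ι) :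
    mutualInfo k v (x ∘ e) = mutualInfo k v x := by
  have : (1 + v⁻¹ • kernelMatrix k (x ∘ e) : Matrix κ κ ℝ)
      = (1 + v⁻¹ • kernelMatrix k x).submatrix e e := by
    ext a b
    simp [kernelMatrix, Matrix.one_apply]
  unfold mutualInfo
  rw [this, Matrix.det_submatrix_equiv_self]

lemma mutualInfo_of_isEmpty [IsEmpty ι] (k : X → X → ℝ) (v : ℝ) (x : ι → X) :
    mutualInfo k v x = 0 := by
  simp [mutualInfo]

variable {H : Type*} [NormedAddCommGroup H] [InnerProductSpace ℝ H] {Φ : X → H}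
  {k : X → X → ℝ} {v : ℝ}

lemma dotProduct_kernel (hk : ∀ a b, k a b = ⟪Φ a, Φ b⟫) (x : ι → X) (u : ι → ℝ) (p : X) :
    (fun a => k p (x a)) ⬝ᵥ u = ⟪Φ p, ∑ a, u a • Φ (x a)⟫ := by
  simp [dotProduct, inner_sum, inner_smul_right, hk, mul_comm]

lemma kernelMatrix_mulVec (hk : ∀ a b, k a b = ⟪Φ a, Φ b⟫) (x : ι → X) (u : ι → ℝ) (b : ι) :
    (kernelMatrix k x *ᵥ u) b = ⟪Φ (x b), ∑ a, u a • Φ (x a)⟫ :=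
  dotProduct_kernel hk x u (x b)

lemma dotProduct_kernelMatrix (hk : ∀ a b, k a b = ⟪Φ a, Φ b⟫) (x : ι → X) (u : ι → ℝ) :
    u ⬝ᵥ (kernelMatrix k x *ᵥ u) = ‖∑ a, u a • Φ (x a)‖ ^ 2 := by
  rw [← real_inner_self_eq_norm_sq]
  conv_rhs => rw [sum_inner]
  simp [dotProduct, kernelMatrix_mulVec hk, inner_smul_left]

lemma regMatrix_mulVec (x : ι → X) (u : ι → ℝ) :
    regMatrix k v x *ᵥ u = kernelMatrix k x *ᵥ u + v • u := by
  simp [regMatrix, Matrix.add_mulVec, Matrix.smul_mulVec]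

lemma regMatrix_isHermitian (hk : ∀ a b, k a b = ⟪Φ a, Φ b⟫) (x : ι → X) :
    (regMatrix k v x).IsHermitian := by
  ext a b
  simp [regMatrix, kernelMatrix, Matrix.one_apply, hk, real_inner_comm, eq_comm]

lemma regMatrix_posDef (hk : ∀ a b, k a b = ⟪Φ a, Φ b⟫) (hv : 0 < v) (x : ι → X) :
    (regMatrix k v x).PosDef := by
  refine .of_dotProduct_mulVec_pos (regMatrix_isHermitian hk x) fun u hu => ?_
  rw [star_trivial, regMatrix_mulVec, dotProduct_add, dotProduct_kernelMatrix hk, dotProduct_smul,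
    smul_eq_mul]
  have : 0 < u ⬝ᵥ u := by simpa using (Matrix.dotProduct_star_self_pos_iff (v := u)).2 hu
  positivity

lemma regMatrix_det_pos (hk : ∀ a b, k a b = ⟪Φ a, Φ b⟫) (hv : 0 < v) (x : ι → X) :
    0 < (regMatrix k v x).det :=
  (regMatrix_posDef hk hv x).det_pos

lemma regMatrix_mulVec_inv (hk : ∀ a b, k a b = ⟪Φ a, Φ b⟫) (hv : 0 < v) (x : ι → X)
    (y : ι → ℝ) : regMatrix k v x *ᵥ ((regMatrix k v x)⁻¹ *ᵥ y) = y := by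
  rw [Matrix.mulVec_mulVec, Matrix.mul_nonsing_inv _ (regMatrix_det_pos hk hv x).ne'.isUnit,
    Matrix.one_mulVec]

lemma regMatrix_inv_mulVec_eq (hk : ∀ a b, k a b = ⟪Φ a, Φ b⟫) (hv : 0 < v) (x : ι → X)
    {y z : ι → ℝ} (h : regMatrix k v x *ᵥ z = y) : (regMatrix k v x)⁻¹ *ᵥ y = z := by
  rw [← h, Matrix.mulVec_mulVec, Matrix.nonsing_inv_mul _ (regMatrix_det_pos hk hv x).ne'.isUnit,
    Matrix.one_mulVec]

/-- The posterior variance is the minimal regularized distance to the span of the features. -/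
lemma postVar_eq_norm_sq (hk : ∀ a b, k a b = ⟪Φ a, Φ b⟫) (hv : 0 < v) (x : ι → X) (p : X)
    {u : ι → ℝ} (hu : u = (regMatrix k v x)⁻¹ *ᵥ (fun a => k p (x a))) :
    postVar k v x p = ‖Φ p - ∑ a, u a • Φ (x a)‖ ^ 2 + v * (u ⬝ᵥ u) := by
  have h : kernelMatrix k x *ᵥ u + v • u = fun a => k p (x a) := by
    rw [← regMatrix_mulVec, hu, regMatrix_mulVec_inv hk hv]
  have h2 : u ⬝ᵥ (fun a => k p (x a)) = ‖∑ a, u a • Φ (x a)‖ ^ 2 + v * (u ⬝ᵥ u) := by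
    rw [← h, dotProduct_add, dotProduct_kernelMatrix hk, dotProduct_smul, smul_eq_mul]
  have h3 := dotProduct_kernel hk x u p
  rw [dotProduct_comm] at h3
  rw [postVar_eq, ← hu, dotProduct_comm, norm_sub_sq_real, ← h3, hk, real_inner_self_eq_norm_sq]
  linarith

lemma postVar_nonneg (hk : ∀ a b, k a b = ⟪Φ a, Φ b⟫) (hv : 0 < v) (x : ι → X) (p : X) :
    0 ≤ postVar k v x p := by
  rw [postVar_eq_norm_sq hk hv x p rfl]
  have := dotProduct_star_self_nonneg ((regMatrix k v x)⁻¹ *ᵥ (fun a => k p (x a)))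
  rw [star_trivial] at this
  positivity

lemma postVar_le (hk : ∀ a b, k a b = ⟪Φ a, Φ b⟫) (hv : 0 < v) (x : ι → X) (p : X) :
    postVar k v x p ≤ k p p := by
  rw [postVar_eq]
  have := (regMatrix_posDef hk hv x).inv.posSemidef.dotProduct_mulVec_nonneg
    (fun a => k p (x a))
  rw [star_trivial] at this
  linarith

lemma one_add_smul_kernelMatrix (hv : 0 < v) (x : ι → X) :
    (1 + v⁻¹ • kernelMatrix k x).det = v⁻¹ ^ Fintype.card ι * (regMatrix k v x).det := by
  rw [← Matrix.det_smul]
  congr 1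
  simp [regMatrix, smul_smul, hv.ne', add_comm]

lemma exp_two_mul_mutualInfo (hk : ∀ a b, k a b = ⟪Φ a, Φ b⟫) (hv : 0 < v) (x : ι → X) :
    Real.exp (2 * mutualInfo k v x) = (1 + v⁻¹ • kernelMatrix k x).det := by
  have : 0 < (1 + v⁻¹ • kernelMatrix k x).det := by
    rw [one_add_smul_kernelMatrix hv]
    have := regMatrix_det_pos hk hv x
    positivity
  rw [mutualInfo, ← mul_assoc]
  norm_num
  exact Real.exp_log this

lemma regMatrix_extend (hk : ∀ a b, k a b = ⟪Φ a, Φ b⟫) (x : ι → X) (p : X) :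
    regMatrix k v (Sum.elim x fun _ : Unit => p) =
      Matrix.fromBlocks (regMatrix k v x) (Matrix.replicateCol Unit fun a => k p (x a))
        (Matrix.replicateRow Unit fun a => k p (x a)) (Matrix.of fun _ _ => k p p + v) := by
  ext (a | a) (b | b) <;>
    simp [regMatrix, kernelMatrix, Matrix.one_apply, hk, real_inner_comm]

/-- The Schur complement of the old block is exactly the predictive variance of the new measurement.
-/
lemma regMatrix_det_extend (hk : ∀ a b, k a b = ⟪Φ a, Φ b⟫) (hv : 0 < v) (x : ι → X) (p : X) :
    (regMatrix k v (Sum.elim x fun _ : Unit => p)).det =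
      (regMatrix k v x).det * (v + postVar k v x p) := by
  have hdet := (regMatrix_det_pos hk hv x).ne'.isUnit
  have := Matrix.invertibleOfIsUnitDet _ hdet
  rw [regMatrix_extend hk, Matrix.det_fromBlocks₁₁, Matrix.invOf_eq_nonsing_inv]
  congr 1
  rw [Matrix.det_unique, postVar_eq, Matrix.sub_apply, Matrix.mul_assoc, Matrix.mul_apply]
  simp only [Matrix.of_apply, Matrix.replicateRow_apply, dotProduct]
  have : ∀ a, ((regMatrix k v x)⁻¹ * Matrix.replicateCol Unit fun a => k p (x a)) a default
      = ((regMatrix k v x)⁻¹ *ᵥ fun a => k p (x a)) a := fun a => rfl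
  simp only [this]
  ring

lemma dataEnergy_extend (hk : ∀ a b, k a b = ⟪Φ a, Φ b⟫) (hv : 0 < v) (x : ι → X) (p : X)
    (y : ι → ℝ) (e : ℝ) :
    dataEnergy k v (Sum.elim x fun _ : Unit => p) (Sum.elim y fun _ => e) =
      dataEnergy k v x y + (e - postMean k v x y p) ^ 2 / (v + postVar k v x p) := by
  have hS : 0 < v + postVar k v x p := add_pos_of_pos_of_nonneg hv (postVar_nonneg hk hv x p)
  set b : ι → ℝ := fun a => k p (x a) with hb
  -- Last coordinate of the solution of the enlarged system: the innovation divided by the Schur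
  -- complement. Back substitution gives the other coordinates in `hsol`.
  set c : ℝ := (e - postMean k v x y p) / (v + postVar k v x p) with hc
  set A := regMatrix k v x with hA
  have hcS : c * (v + postVar k v x p) = e - postMean k v x y p := by
    rw [hc]; field_simp
  have hsymm : y ⬝ᵥ (A⁻¹ *ᵥ b) = postMean k v x y p := by
    rw [postMean_eq, ← hA, ← hb, Matrix.dotProduct_mulVec, ← Matrix.mulVec_transpose,
      dotProduct_comm]
    congr 2
    have := (regMatrix_isHermitian (v := v) hk x).inv
    simpa [Matrix.IsHermitian, Matrix.conjTranspose_eq_transpose_of_trivial] using this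
  have hsol : regMatrix k v (Sum.elim x fun _ : Unit => p) *ᵥ
      Sum.elim (A⁻¹ *ᵥ y - c • (A⁻¹ *ᵥ b)) (fun _ => c) = Sum.elim y fun _ => e := by
    rw [regMatrix_extend hk, Matrix.fromBlocks_mulVec]
    congr 1
    · ext a
      simp only [Sum.elim_comp_inl, Sum.elim_comp_inr, Matrix.mulVec_sub, Matrix.mulVec_smul]
      rw [← hA, hA, regMatrix_mulVec_inv hk hv, regMatrix_mulVec_inv hk hv]
      simp [Matrix.mulVec, dotProduct, hb, mul_comm]
    · ext a
      simp only [Sum.elim_comp_inl, Sum.elim_comp_inr, Pi.add_apply]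
      have h1 : (Matrix.replicateRow Unit b *ᵥ (A⁻¹ *ᵥ y - c • (A⁻¹ *ᵥ b))) a
          = b ⬝ᵥ (A⁻¹ *ᵥ y) - c * (b ⬝ᵥ (A⁻¹ *ᵥ b)) := by
        change b ⬝ᵥ _ = _
        rw [dotProduct_sub, dotProduct_smul, smul_eq_mul]
      rw [h1]
      have h2 : b ⬝ᵥ (A⁻¹ *ᵥ y) = postMean k v x y p := rfl
      have h3 : postVar k v x p = k p p - b ⬝ᵥ (A⁻¹ *ᵥ b) := rfl
      have h4 : ((Matrix.of fun _ _ => k p p + v : Matrix Unit Unit ℝ) *ᵥ fun _ => c) a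
          = (k p p + v) * c := by simp [Matrix.mulVec, dotProduct]
      rw [h2, h4]
      rw [h3] at hcS
      linarith
  unfold dataEnergy
  rw [regMatrix_inv_mulVec_eq hk hv _ hsol, ← hA]
  simp only [sumElim_dotProduct_sumElim, dotProduct_sub, dotProduct_smul, smul_eq_mul]
  rw [hsymm]
  have h5 : (fun _ : Unit => e) ⬝ᵥ (fun _ => c) = e * c := by simp [dotProduct]
  have h6 : (e - postMean k v x y p) ^ 2 / (v + postVar k v x p)
      = c * (e - postMean k v x y p) := by rw [hc]; ring
  rw [h5, h6]
  ring

/-- Chain rule for information, read off from the factorization of the determinant. -/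
lemma mutualInfo_extend (hk : ∀ a b, k a b = ⟪Φ a, Φ b⟫) (hv : 0 < v) (x : ι → X) (p : X) :
    mutualInfo k v (Sum.elim x fun _ : Unit => p) =
      mutualInfo k v x + 1 / 2 * Real.log (1 + v⁻¹ * postVar k v x p) := by
  have h0 := postVar_nonneg hk hv x p
  have h1 : (1 + v⁻¹ • kernelMatrix k (Sum.elim x fun _ : Unit => p)).det
      = (1 + v⁻¹ • kernelMatrix k x).det * (1 + v⁻¹ * postVar k v x p) := by
    rw [one_add_smul_kernelMatrix hv, one_add_smul_kernelMatrix hv, regMatrix_det_extend hk hv]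
    simp only [Fintype.card_sum, Fintype.card_unit, pow_succ]
    field_simp
  have h2 : (1 + v⁻¹ • kernelMatrix k x).det ≠ 0 := by
    rw [← exp_two_mul_mutualInfo hk hv]; exact (Real.exp_pos _).ne'
  rw [mutualInfo, h1, Real.log_mul h2 (by positivity), mutualInfo]
  ring

lemma mutualInfo_le_extend (hk : ∀ a b, k a b = ⟪Φ a, Φ b⟫) (hv : 0 < v) (x : ι → X) (p : X) :
    mutualInfo k v x ≤ mutualInfo k v (Sum.elim x fun _ : Unit => p) := by
  rw [mutualInfo_extend hk hv]
  have h0 := postVar_nonneg hk hv x p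
  have : 0 ≤ Real.log (1 + v⁻¹ * postVar k v x p) :=
    Real.log_nonneg (le_add_of_nonneg_right (by positivity))
  linarith

lemma mutualInfo_le_sumElim (hk : ∀ a b, k a b = ⟪Φ a, Φ b⟫) (hv : 0 < v) (x : ι → X)
    (y : κ → X) : mutualInfo k v x ≤ mutualInfo k v (Sum.elim x y) := by
  suffices h : ∀ n (z : Fin n → X), mutualInfo k v x ≤ mutualInfo k v (Sum.elim x z) by
    have e := Fintype.equivFin κ
    have := h _ (y ∘ e.symm)
    rw [← mutualInfo_comp_equiv k v _ ((Equiv.refl ι).sumCongr e)] at this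
    convert this using 2
    ext (a | a) <;> simp
  intro n
  induction n with
  | zero =>
    intro z
    rw [← mutualInfo_comp_equiv k v _ (Equiv.sumEmpty ι (Fin 0)).symm]
    rfl
  | succ n ih =>
    intro z
    let e : (ι ⊕ Fin n) ⊕ Unit ≃ ι ⊕ Fin (n + 1) :=
      (Equiv.sumAssoc ι (Fin n) Unit).trans
        ((Equiv.refl ι).sumCongr (((Equiv.refl (Fin n)).sumCongr finOneEquiv.symm).trans
          finSumFinEquiv))
    refine (ih (fun i => z i.castSucc)).trans ((mutualInfo_le_extend hk hv _ (z (Fin.last n))).trans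
      (le_of_eq ?_))
    rw [← mutualInfo_comp_equiv k v _ e]
    congr 1
    ext ((a | a) | a) <;> rfl

/-- The indices missed by `g` are additional measurements, and these never lose information.
Injectivity concerns indices only; the points may repeat. -/
lemma mutualInfo_comp_le (hk : ∀ a b, k a b = ⟪Φ a, Φ b⟫) (hv : 0 < v) (x : ι → X) {g : κ → ι}
    (hg : Function.Injective g) : mutualInfo k v (x ∘ g) ≤ mutualInfo k v x := by
  classical
  let e : κ ⊕ {a // a ∉ Set.range g} ≃ ι :=
    ((Equiv.ofInjective g hg).sumCongr (Equiv.refl _)).trans (Equiv.sumCompl (· ∈ Set.range g))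
  refine (mutualInfo_le_sumElim hk hv (x ∘ g)
    (fun a : {a // a ∉ Set.range g} => x a)).trans (le_of_eq ?_)
  rw [← mutualInfo_comp_equiv k v x e]
  congr 1
  ext (a | a) <;> rfl

lemma mutualInfo_nonneg (hk : ∀ a b, k a b = ⟪Φ a, Φ b⟫) (hv : 0 < v) (x : ι → X) :
    0 ≤ mutualInfo k v x := by
  have h := mutualInfo_comp_le hk hv x (g := (Fin.elim0 : Fin 0 → ι)) (fun a => a.elim0)
  rwa [mutualInfo_of_isEmpty] at h

/-- Needed to know that the supremum in `infoCapacity` is over a bounded set; a real supremum of an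
unbounded set would be the default value 0. -/
lemma mutualInfo_fin_le (hk : ∀ a b, k a b = ⟪Φ a, Φ b⟫) (hv : 0 < v) (h1 : ∀ a, k a a ≤ 1)
    (n : ℕ) (x : Fin n → X) : mutualInfo k v x ≤ n * (1 / 2 * Real.log (1 + v⁻¹)) := by
  induction n with
  | zero => simp [mutualInfo_of_isEmpty]
  | succ n ih =>
    let e : Fin n ⊕ Unit ≃ Fin (n + 1) :=
      ((Equiv.refl (Fin n)).sumCongr finOneEquiv.symm).trans finSumFinEquiv
    have hx : x ∘ e = Sum.elim (fun i => x i.castSucc) fun _ : Unit => x (Fin.last n) := by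
      ext (a | a) <;> rfl
    rw [← mutualInfo_comp_equiv k v x e, hx, mutualInfo_extend hk hv]
    have h0 := postVar_nonneg hk hv (fun i : Fin n => x i.castSucc) (x (Fin.last n))
    have h2 := (postVar_le hk hv (fun i : Fin n => x i.castSucc) (x (Fin.last n))).trans (h1 _)
    have h3 : Real.log (1 + v⁻¹ * postVar k v (fun i : Fin n => x i.castSucc) (x (Fin.last n)))
        ≤ Real.log (1 + v⁻¹) := by
      apply Real.log_le_log (by positivity)
      have : 0 < v⁻¹ := by positivity
      nlinarith
    have := ih (fun i => x i.castSucc)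
    push_cast
    linarith

lemma mutualInfo_le_infoCapacity (hk : ∀ a b, k a b = ⟪Φ a, Φ b⟫) (hv : 0 < v)
    (h1 : ∀ a, k a a ≤ 1) {n : ℕ} (x : ι → X) (hn : Fintype.card ι = n) :
    mutualInfo k v x ≤ infoCapacity k v n := by
  subst hn
  rw [← mutualInfo_comp_equiv k v x (Fintype.equivFin ι).symm]
  exact le_ciSup (f := fun z : Fin (Fintype.card ι) → X => mutualInfo k v z)
    ⟨_, by rintro _ ⟨z, rfl⟩; exact mutualInfo_fin_le hk hv h1 _ z⟩ _

/-- Deterministic confidence bound: the regression error is controlled by the norm of the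
function and by the energy of the noise. -/
lemma abs_sub_postMean_le (hk : ∀ a b, k a b = ⟪Φ a, Φ b⟫) (hv : 0 < v) (x : ι → X) (p : X)
    (f : H) (e : ι → ℝ) {C : ℝ} (hC : v⁻¹ * (e ⬝ᵥ e) - dataEnergy k v x e ≤ C ^ 2) (hC0 : 0 ≤ C) :
    |⟪f, Φ p⟫ - postMean k v x (fun a => ⟪f, Φ (x a)⟫ + e a) p|
      ≤ (‖f‖ + C) * postStd k v x p := by
  set b : ι → ℝ := fun a => k p (x a) with hb
  set A := regMatrix k v x with hA
  set α := A⁻¹ *ᵥ b with hα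
  set u := A⁻¹ *ᵥ e with hu
  set s := postStd k v x p with hs
  have hs0 : 0 ≤ s := Real.sqrt_nonneg _
  have hs2 : s ^ 2 = ‖Φ p - ∑ a, α a • Φ (x a)‖ ^ 2 + v * (α ⬝ᵥ α) := by
    rw [hs, postStd, Real.sq_sqrt (postVar_nonneg hk hv x p), postVar_eq_norm_sq hk hv x p rfl]
  have dn : ∀ z : ι → ℝ, 0 ≤ z ⬝ᵥ z := fun z => by simpa using dotProduct_star_self_nonneg z
  have hsymm : ∀ z : ι → ℝ, b ⬝ᵥ (A⁻¹ *ᵥ z) = α ⬝ᵥ z := by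
    intro z
    rw [hα, Matrix.dotProduct_mulVec, ← Matrix.mulVec_transpose]
    congr 2
    have := (regMatrix_isHermitian (v := v) hk x).inv
    simpa [Matrix.IsHermitian, Matrix.conjTranspose_eq_transpose_of_trivial] using this
  -- Bias plus noise: `r` is the residual of regressing `Φ p` on the sampled features, and `b ⬝ᵥ u`
  -- is the regression of the noise alone.
  have hsplit : ⟪f, Φ p⟫ - postMean k v x (fun a => ⟪f, Φ (x a)⟫ + e a) p
      = ⟪f, Φ p - ∑ a, α a • Φ (x a)⟫ - b ⬝ᵥ u := by
    rw [postMean_eq, ← hb, ← hA, hsymm, hu, hsymm]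
    simp only [inner_sub_right, inner_sum, inner_smul_right, dotProduct, mul_add,
      Finset.sum_add_distrib]
    ring
  set h := ∑ a, u a • Φ (x a) with hh
  set r := Φ p - ∑ a, α a • Φ (x a) with hr
  have hAu : kernelMatrix k x *ᵥ u + v • u = e := by
    rw [← regMatrix_mulVec, hu, hA, regMatrix_mulVec_inv hk hv]
  set g := kernelMatrix k x *ᵥ u with hg
  -- Substituting `e = g + v u` with `g = K u` cancels the `u ⬝ᵥ u` terms.
  have hR : v⁻¹ * (e ⬝ᵥ e) - dataEnergy k v x e = ‖h‖ ^ 2 + v⁻¹ * (g ⬝ᵥ g) := by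
    have h1 : dataEnergy k v x e = e ⬝ᵥ u := rfl
    have h2 : u ⬝ᵥ g = ‖h‖ ^ 2 := dotProduct_kernelMatrix hk x u
    rw [h1, ← hAu]
    simp only [dotProduct_add, add_dotProduct, dotProduct_smul, smul_dotProduct, smul_eq_mul]
    rw [dotProduct_comm g u, h2]
    field_simp
    ring
  have hbu : b ⬝ᵥ u = ⟪r, h⟫ + α ⬝ᵥ g := by
    have h1 : b ⬝ᵥ u = ⟪Φ p, h⟫ := dotProduct_kernel hk x u p
    have h2 : α ⬝ᵥ g = ⟪∑ a, α a • Φ (x a), h⟫ := by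
      simp only [dotProduct, hg, kernelMatrix_mulVec hk, sum_inner, inner_smul_left]
      rfl
    rw [h1, h2, ← inner_add_left, hr, sub_add_cancel]
  have hrs : ‖r‖ ≤ s := by
    refine (sq_le_sq₀ (norm_nonneg _) hs0).1 ?_
    rw [hs2]
    nlinarith [dn α]
  have hfr : |⟪f, r⟫| ≤ ‖f‖ * s :=
    (abs_real_inner_le_norm f r).trans (mul_le_mul_of_nonneg_left hrs (norm_nonneg _))
  have hag : |α ⬝ᵥ g| ≤ √(α ⬝ᵥ α) * √(g ⬝ᵥ g) := by
    rw [← Real.sqrt_mul (dn _), ← Real.sqrt_sq_eq_abs]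
    apply Real.sqrt_le_sqrt
    have := Finset.sum_mul_sq_le_sq_mul_sq Finset.univ α g
    simpa [dotProduct, sq] using this
  have hrh : |b ⬝ᵥ u| ≤ C * s := by
    rw [hbu]
    refine (abs_add_le _ _).trans ((add_le_add (abs_real_inner_le_norm r h) hag).trans ?_)
    refine abs_le_of_sq_le_sq' ?_ (by positivity) |>.2
    have e1 := Real.sq_sqrt (dn α)
    have e2 := Real.sq_sqrt (dn g)
    set P := √(α ⬝ᵥ α)
    set Q := √(g ⬝ᵥ g)
    -- Cauchy-Schwarz with weights `v` and `v⁻¹`: the first factor is the posterior variance, the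
    -- second the noise quantity bounded by `C ^ 2`. The defect is an explicit square.
    have h3 : (‖r‖ * ‖h‖ + P * Q) ^ 2 ≤ (‖r‖ ^ 2 + v * P ^ 2) * (‖h‖ ^ 2 + v⁻¹ * Q ^ 2) := by
      have : (‖r‖ ^ 2 + v * P ^ 2) * (‖h‖ ^ 2 + v⁻¹ * Q ^ 2) - (‖r‖ * ‖h‖ + P * Q) ^ 2
          = v⁻¹ * (‖r‖ * Q - v * P * ‖h‖) ^ 2 := by
        field_simp
        ring
      have h4 : 0 ≤ v⁻¹ * (‖r‖ * Q - v * P * ‖h‖) ^ 2 := by positivity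
      linarith
    rw [e1, e2, ← hs2, ← hR] at h3
    refine h3.trans ?_
    rw [mul_pow, mul_comm]
    exact mul_le_mul_of_nonneg_right hC (sq_nonneg s)
  rw [hsplit]
  calc |⟪f, r⟫ - b ⬝ᵥ u| ≤ |⟪f, r⟫| + |b ⬝ᵥ u| := abs_sub _ _
    _ ≤ _ := by linarith

end Regression

/-! ### Parse trees under pessimistic evaluation. -/

lemma Spec.lower_le_value {q : ℕ} (φ : Spec q) {l u v : Fin q → ℝ} (hl : ∀ i, l i ≤ v i)
    (hu : ∀ i, v i ≤ u i) : φ.lower l u ≤ φ.value v := by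
  induction φ with
  | pred i => exact hl i
  | negPred i => exact neg_le_neg (hu i)
  | conj a b iha ihb => exact min_le_min iha ihb
  | disj a b iha ihb => exact max_le_max iha ihb

/-- `min` and `max` are monotone and commute with adding a constant, so a leafwise error passes to
the root without growing. -/
lemma Spec.value_le_lower_add {q : ℕ} (φ : Spec q) {l u v : Fin q → ℝ} {C : ℝ}
    (hl : ∀ i, v i ≤ l i + C) (hu : ∀ i, u i ≤ v i + C) :
    φ.value v ≤ φ.lower l u + C := by
  induction φ with
  | pred i => exact hl i
  | negPred i => simp only [Spec.value, Spec.lower]; linarith [hu i]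
  | conj a b iha ihb =>
    simp only [Spec.value, Spec.lower, ← min_add_add_right]
    exact min_le_min iha ihb
  | disj a b iha ihb =>
    simp only [Spec.value, Spec.lower, ← max_add_add_right]
    exact max_le_max iha ihb

lemma betaSqrt_mono {B σ δ I J : ℝ} (h : I ≤ J) : betaSqrt B σ δ I ≤ betaSqrt B σ δ J := by
  unfold betaSqrt
  have : 0 ≤ max (4 * σ) (√2) := le_max_of_le_right (Real.sqrt_nonneg _)
  gcongr

/-! ### Information gain along the run and the deterministic verification argument. -/

section

variable {W : Type*} {q : ℕ} {H : Type*} [NormedAddCommGroup H] [InnerProductSpace ℝ H]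
  {Φ : W × Fin q → H} {k : W × Fin q → W × Fin q → ℝ} {v : ℝ}

lemma mutualInfo_inputs_mono (hk : ∀ a b, k a b = ⟪Φ a, Φ b⟫) (hv : 0 < v) (w : ℕ → W) {m n : ℕ}
    (h : m ≤ n) : mutualInfo k v (inputs (q := q) w m) ≤ mutualInfo k v (inputs (q := q) w n) :=
  mutualInfo_comp_le hk hv (inputs w n) (g := Prod.map (Fin.castLE h) id)
    ((Fin.castLE_injective h).prodMap Function.injective_id)

/-- Of the `q` measurements of a round only one is kept. Discarding the others only loses
information, and the variance may then be conditioned on complete rounds. -/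
lemma mutualInfo_inputs_succ (hk : ∀ a b, k a b = ⟪Φ a, Φ b⟫) (hv : 0 < v) (w : ℕ → W) (n : ℕ)
    (i : Fin q) :
    mutualInfo k v (inputs (q := q) w n)
        + 1 / 2 * Real.log (1 + v⁻¹ * postVar k v (inputs (q := q) w n) (w n, i))
      ≤ mutualInfo k v (inputs (q := q) w (n + 1)) := by
  rw [← mutualInfo_extend hk hv]
  let g : (Fin n × Fin q) ⊕ Unit → Fin (n + 1) × Fin q :=
    Sum.elim (Prod.map Fin.castSucc id) fun _ => (Fin.last n, i)
  have hg : Function.Injective g := by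
    refine ((Fin.castSucc_injective n).prodMap Function.injective_id).sumElim
      (fun a b _ => rfl) fun a b h => ?_
    exact (Fin.castSucc_lt_last a.1).ne (congrArg Prod.fst h)
  refine le_of_eq_of_le ?_ (mutualInfo_comp_le hk hv (inputs w (n + 1)) hg)
  congr 1
  ext (a | a) <;> rfl

/-- Concavity: on `[1, 1 + a]` the logarithm lies above its chord. This converts information gains
into variances and puts `log (1 + σ⁻²)` into `C₁`. -/
lemma mul_log_le_log_one_add_mul {a s : ℝ} (ha : 0 ≤ a) (hs : 0 ≤ s) (hs1 : s ≤ 1) :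
    s * Real.log (1 + a) ≤ Real.log (1 + a * s) := by
  have h := strictConcaveOn_log_Ioi.concaveOn.2 (Set.mem_Ioi.2 one_pos)
    (Set.mem_Ioi.2 (by positivity : 0 < 1 + a)) (sub_nonneg.2 hs1) hs (by ring)
  have e : (1 - s) • (1 : ℝ) + s • (1 + a) = 1 + a * s := by
    simp only [smul_eq_mul]
    ring
  rw [e] at h
  simpa using h

/-- The posterior variances along the run are controlled by the information gain. -/
lemma sum_postVar_le (hk : ∀ a b, k a b = ⟪Φ a, Φ b⟫) (hv : 0 < v) (h1 : ∀ a, k a a ≤ 1)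
    (w : ℕ → W) (i : ℕ → Fin q) (n : ℕ) :
    (∑ j ∈ Finset.range n, postVar k v (inputs (q := q) w j) (w j, i j)) * Real.log (1 + v⁻¹)
      ≤ 2 * mutualInfo k v (inputs (q := q) w n) := by
  induction n with
  | zero => simp [mutualInfo_of_isEmpty]
  | succ n ih =>
    rw [Finset.sum_range_succ, add_mul]
    have h := mutualInfo_inputs_succ hk hv w n (i n)
    have h2 := mul_log_le_log_one_add_mul (inv_nonneg.2 hv.le)
      (postVar_nonneg hk hv (inputs (q := q) w n) (w n, i n))
      ((postVar_le hk hv (inputs (q := q) w n) (w n, i n)).trans (h1 _))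
    linarith

/-- If the confidence bounds are valid, a run whose information gain is small against its length
has found a falsifying environment or verified the system. -/
lemma value_pos_of_confidence (φ : Spec q) (hk : ∀ a b, k a b = ⟪Φ a, Φ b⟫)
    (h1 : ∀ a, k a a ≤ 1) {B σ δ ε : ℝ} (hσ : 0 < σ) (hε : 0 < ε)
    (f : W × Fin q → ℝ) (w : ℕ → W) (y : ℕ → Fin q → ℝ)
    (hconf : ∀ n e i, |f (e, i) - postMean k (σ ^ 2) (inputs w n) (outputs y n) (e, i)|
      ≤ roundBetaSqrt k B σ δ w n * postStd k (σ ^ 2) (inputs w n) (e, i))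
    (hsel : ∀ n, IsMinOn (acquisition φ k B σ δ w y n) Set.univ (w n))
    {N : ℕ} (hN : 1 ≤ N)
    (hbudget : 8 / Real.log (1 + σ⁻¹ ^ 2) * roundBetaSqrt k B σ δ w (N - 1) ^ 2
      * infoCapacity k (σ ^ 2) (q * N) ≤ ε ^ 2 * N)
    {n : ℕ} (hn : N ≤ n) {wHat : W} (hbest : IsBestSample (fun e => φ.value fun i => f (e, i)) w n
      wHat) (hpos : ε < φ.value fun i => f (wHat, i)) (e : W) :
    0 < φ.value fun i => f (e, i) := by
  have hv : 0 < σ ^ 2 := by positivity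
  by_contra! hneg
  -- Otherwise `φ(w j) ≤ acquisition(w j) + ε ≤ acquisition(e) + ε ≤ φ(e) + ε ≤ ε`, whereas `φ(w j)
  -- ≥ φ(wHat) > ε`.
  have hwide : ∀ j < N, ∃ i, ε < 2 * (roundBetaSqrt k B σ δ w j *
      postStd k (σ ^ 2) (inputs w j) (w j, i)) := by
    intro j hj
    by_contra! hC
    have hlow : φ.lower (lcb k B σ δ w y j e) (ucb k B σ δ w y j e)
        ≤ φ.value fun i => f (e, i) := by
      apply φ.lower_le_value
      · intro i
        have := abs_le.1 (hconf j e i)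
        unfold lcb; linarith
      · intro i
        have := abs_le.1 (hconf j e i)
        unfold ucb; linarith
    have hup : φ.value (fun i => f (w j, i))
        ≤ φ.lower (lcb k B σ δ w y j (w j)) (ucb k B σ δ w y j (w j)) + ε := by
      apply φ.value_le_lower_add
      · intro i
        have := abs_le.1 (hconf j (w j) i)
        have := hC i
        unfold lcb; linarith
      · intro i
        have := abs_le.1 (hconf j (w j) i)
        have := hC i
        unfold ucb; linarith
    have hs : φ.lower (lcb k B σ δ w y j (w j)) (ucb k B σ δ w y j (w j))
        ≤ φ.lower (lcb k B σ δ w y j e) (ucb k B σ δ w y j e) := hsel j (Set.mem_univ e)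
    have := hbest.2 j (hj.trans_le hn)
    simp only at this
    linarith
  -- Only a default index for the rounds from `N` on, so that `choose` yields a total function.
  obtain ⟨i0, -⟩ := hwide 0 hN
  have hwide' : ∀ j, ∃ i, j < N → ε < 2 * (roundBetaSqrt k B σ δ w j *
      postStd k (σ ^ 2) (inputs w j) (w j, i)) := fun j => by
    by_cases hj : j < N
    · obtain ⟨i, hi⟩ := hwide j hj
      exact ⟨i, fun _ => hi⟩
    · exact ⟨i0, fun h => absurd h hj⟩
  choose i hi using hwide'
  set b := roundBetaSqrt k B σ δ w (N - 1) with hb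
  have hterm : ∀ j ∈ Finset.range N,
      ε ^ 2 < 4 * b ^ 2 * postVar k (σ ^ 2) (inputs w j) (w j, i j) := by
    intro j hj
    rw [Finset.mem_range] at hj
    have h0 : 0 ≤ postStd k (σ ^ 2) (inputs w j) (w j, i j) := Real.sqrt_nonneg _
    -- Information grows along the run, so the multiplier selecting the `N`-th environment, based on
    -- `N - 1` rounds, dominates all earlier ones.
    have hle : roundBetaSqrt k B σ δ w j ≤ b :=
      betaSqrt_mono (mutualInfo_inputs_mono hk hv w (by omega))
    have h2 : ε < 2 * (b * postStd k (σ ^ 2) (inputs w j) (w j, i j)) :=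
      (hi j hj).trans_le (by gcongr)
    calc ε ^ 2 < (2 * (b * postStd k (σ ^ 2) (inputs w j) (w j, i j))) ^ 2 :=
          pow_lt_pow_left₀ h2 hε.le two_ne_zero
      _ = 4 * b ^ 2 * postStd k (σ ^ 2) (inputs w j) (w j, i j) ^ 2 := by ring
      _ = _ := by rw [postStd, Real.sq_sqrt (postVar_nonneg hk hv _ _)]
  have hsum := Finset.sum_lt_sum_of_nonempty (Finset.nonempty_range_iff.2 (by omega)) hterm
  rw [Finset.sum_const, Finset.card_range, nsmul_eq_mul, ← Finset.mul_sum] at hsum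
  have hlog : 0 < Real.log (1 + (σ ^ 2)⁻¹) := Real.log_pos (lt_add_of_pos_right _ (by positivity))
  have hinfo := (sum_postVar_le hk hv h1 w i N).trans (mul_le_mul_of_nonneg_left
    (mutualInfo_le_infoCapacity hk hv h1 (inputs (q := q) w N) (n := q * N) (by simp [mul_comm]))
    zero_le_two)
  rw [← le_div_iff₀ hlog] at hinfo
  rw [inv_pow] at hbudget
  have : 4 * b ^ 2 * ∑ j ∈ Finset.range N, postVar k (σ ^ 2) (inputs w j) (w j, i j)
      ≤ 4 * b ^ 2 * (2 * infoCapacity k (σ ^ 2) (q * N) / Real.log (1 + (σ ^ 2)⁻¹)) := by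
    gcongr
  have h8 : 4 * b ^ 2 * (2 * infoCapacity k (σ ^ 2) (q * N) / Real.log (1 + (σ ^ 2)⁻¹))
      = 8 / Real.log (1 + (σ ^ 2)⁻¹) * b ^ 2 * infoCapacity k (σ ^ 2) (q * N) := by ring
  linarith

end

/-! ### Ville's maximal inequality. -/

section Ville

variable {Ω : Type*} {mΩ : MeasurableSpace Ω} {P : Measure Ω}

/-- Ville's inequality for nonnegative supermartingales, in Lebesgue integral form. -/
lemma mul_measure_exists_le_of_supermartingale (ℱ : Filtration ℕ mΩ) {M : ℕ → Ω → ℝ≥0∞}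
    (hM : ∀ t, Measurable[ℱ t] (M t))
    (hstep : ∀ t A, MeasurableSet[ℱ t] A → ∫⁻ ω in A, M (t + 1) ω ∂P ≤ ∫⁻ ω in A, M t ω ∂P)
    (c : ℝ≥0∞) : c * P {ω | ∃ t, c ≤ M t ω} ≤ ∫⁻ ω, M 0 ω ∂P := by
  let A : ℕ → Set Ω := fun t => {ω | ∃ s ≤ t, c ≤ M s ω}
  have hA : ∀ t, MeasurableSet[ℱ t] (A t) := by
    intro t
    have : A t = ⋃ s ∈ Set.Iic t, {ω | c ≤ M s ω} := by ext; simp [A]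
    rw [this]
    exact MeasurableSet.biUnion (Set.to_countable _) fun s hs =>
      measurableSet_le measurable_const ((hM s).mono (ℱ.mono hs) le_rfl)
  have hA' : ∀ t, MeasurableSet (A t) := fun t => ℱ.le t _ (hA t)
  -- The process stopped at its first crossing of `c`, with its value there lowered to `c`, keeps
  -- expectation at most that of `M 0`.
  have key : ∀ t, c * P (A t) + ∫⁻ ω in (A t)ᶜ, M t ω ∂P ≤ ∫⁻ ω, M 0 ω ∂P := by
    intro t
    induction t with
    | zero =>
      rw [← lintegral_add_compl (μ := P) (M 0) (hA' 0)]
      have h0 : ∀ ω ∈ A 0, c ≤ M 0 ω := by simp [A]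
      exact add_le_add_left ((setLIntegral_const _ _).symm.trans_le
        (setLIntegral_mono' (hA' 0) h0)) _
    | succ t ih =>
      have hsub : A t ⊆ A (t + 1) := fun ω ⟨s, hs, h⟩ => ⟨s, hs.trans t.le_succ, h⟩
      refine le_trans ?_ ih
      calc c * P (A (t + 1)) + ∫⁻ ω in (A (t + 1))ᶜ, M (t + 1) ω ∂P
          = c * P (A t) + (c * P (A (t + 1) \ A t)
            + ∫⁻ ω in (A (t + 1))ᶜ, M (t + 1) ω ∂P) := by
            rw [← add_assoc, ← mul_add, measure_add_sdiff (hA' t).nullMeasurableSet,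
              Set.union_eq_self_of_subset_left hsub]
        _ ≤ c * P (A t) + (∫⁻ ω in A (t + 1) \ A t, M (t + 1) ω ∂P
            + ∫⁻ ω in (A (t + 1))ᶜ, M (t + 1) ω ∂P) := by
            gcongr
            refine (setLIntegral_const _ _).symm.trans_le
              (setLIntegral_mono' ((hA' _).diff (hA' t)) ?_)
            rintro ω ⟨⟨s, hs, h⟩, hn⟩
            rcases hs.eq_or_lt with rfl | hlt
            · exact h
            · exact absurd ⟨s, Nat.lt_succ_iff.1 hlt, h⟩ hn
        _ = c * P (A t) + ∫⁻ ω in (A t)ᶜ, M (t + 1) ω ∂P := by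
            rw [← lintegral_union (hA' _).compl]
            · congr 3
              ext ω
              have := @hsub ω
              simp only [Set.mem_union, Set.mem_sdiff, Set.mem_compl_iff]
              tauto
            · exact Set.disjoint_left.2 fun ω h1 h2 => h2 h1.1
        _ ≤ _ := add_le_add_right (hstep t _ (hA t).compl) _
  have hU : {ω | ∃ t, c ≤ M t ω} = ⋃ t, A t := by
    ext ω
    simp only [Set.mem_ofPred_eq, Set.mem_iUnion, A]
    exact ⟨fun ⟨t, h⟩ => ⟨t, t, le_rfl, h⟩, fun ⟨_, s, _, h⟩ => ⟨s, h⟩⟩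
  have hmono : Monotone A := fun s t hst ω ⟨r, hr, h⟩ => ⟨r, hr.trans hst, h⟩
  rw [hU, hmono.measure_iUnion, ENNReal.mul_iSup]
  exact iSup_le fun t => le_self_add.trans (key t)

end Ville

/-! ### Gaussian mixtures of exponential supermartingale increments. -/

section Mixture

variable {Ω : Type*} {m mΩ : MeasurableSpace Ω} {P : Measure Ω} [IsProbabilityMeasure P]
  {σ : ℝ} {ξ : Ω → ℝ}

/-- The conditional bound is a comparison of two measures restricted to `m`, hence holds against
every nonnegative `m`-measurable weight, integrable or not. -/
lemma CondSubGaussian.lintegral_mul_exp_le (hm : m ≤ mΩ) (hsub : CondSubGaussian P m σ ξ)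
    (hξ : Measurable ξ) (s : ℝ) {h : Ω → ℝ≥0∞} (hh : Measurable[m] h) :
    ∫⁻ ω, h ω * ENNReal.ofReal (Real.exp (s * ξ ω)) ∂P
      ≤ ∫⁻ ω, h ω * ENNReal.ofReal (Real.exp (s ^ 2 * σ ^ 2 / 2)) ∂P := by
  obtain ⟨hint, hle⟩ := hsub s
  have hmeas : Measurable fun ω => ENNReal.ofReal (Real.exp (s * ξ ω)) := by fun_prop
  set c : ℝ≥0∞ := ENNReal.ofReal (Real.exp (s ^ 2 * σ ^ 2 / 2)) with hc
  have hμ : (P.withDensity fun ω => ENNReal.ofReal (Real.exp (s * ξ ω))).trim hm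
      ≤ (c • P).trim hm := by
    refine Measure.le_iff.2 fun A hA => ?_
    rw [trim_measurableSet_eq hm hA, trim_measurableSet_eq hm hA, withDensity_apply _ (hm A hA),
      ← ofReal_integral_eq_lintegral_ofReal hint.restrict
        (Filter.Eventually.of_forall fun ω => (Real.exp_pos _).le),
      ← setIntegral_condExp hm hint hA]
    have : ∫ ω in A, (P[fun ω => Real.exp (s * ξ ω) | m]) ω ∂P
        ≤ ∫ ω in A, Real.exp (s ^ 2 * σ ^ 2 / 2) ∂P :=
      integral_mono_ae integrable_condExp.restrict (integrable_const _)
        (ae_restrict_of_ae hle)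
    refine (ENNReal.ofReal_le_ofReal this).trans (le_of_eq ?_)
    rw [setIntegral_const, smul_eq_mul, ENNReal.ofReal_mul measureReal_nonneg, ofReal_measureReal,
      Measure.smul_apply, smul_eq_mul, mul_comm]
  have h1 := lintegral_mono' hμ (le_refl h)
  rw [lintegral_trim hm hh, lintegral_trim hm hh, lintegral_smul_measure,
    lintegral_withDensity_eq_lintegral_mul _ hmeas (hh.mono hm le_rfl)] at h1
  rw [lintegral_mul_const _ (hh.mono hm le_rfl), mul_comm _ c]
  simpa [mul_comm] using h1

/-- The likelihood ratio of a standard Gaussian observation whose mean has a Gaussian prior with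
mean `a` and variance `r`. -/
noncomputable def mixtureRatio (a r e : ℝ) : ℝ :=
  (√(1 + r))⁻¹ * Real.exp ((e ^ 2 - (e - a) ^ 2 / (1 + r)) / 2)

/-- Completing the square in `z`, i.e. Bayes' rule with a Gaussian prior and unit observation noise.
-/
lemma exp_mul_gaussianPDFReal (a e z : ℝ) {r : ℝ} (hr : 0 < r) :
    Real.exp (z * e - z ^ 2 / 2) * ProbabilityTheory.gaussianPDFReal a r.toNNReal z
      = mixtureRatio a r e
        * ProbabilityTheory.gaussianPDFReal ((a + r * e) / (1 + r)) (r / (1 + r)).toNNReal z := by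
  have h1 : 0 < 1 + r := by linarith
  simp only [ProbabilityTheory.gaussianPDFReal, mixtureRatio, Real.coe_toNNReal _ hr.le,
    Real.coe_toNNReal _ (div_pos hr h1).le]
  have hs : √(2 * Real.pi * r) = √(1 + r) * √(2 * Real.pi * (r / (1 + r))) := by
    rw [← Real.sqrt_mul h1.le]
    congr 1
    field_simp
  have hE : Real.exp (z * e - z ^ 2 / 2) * Real.exp (-(z - a) ^ 2 / (2 * r))
      = Real.exp ((e ^ 2 - (e - a) ^ 2 / (1 + r)) / 2)
        * Real.exp (-(z - (a + r * e) / (1 + r)) ^ 2 / (2 * (r / (1 + r)))) := by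
    rw [← Real.exp_add, ← Real.exp_add]
    congr 1
    field_simp
    ring
  rw [hs, mul_inv]
  linear_combination ((√(1 + r))⁻¹ * (√(2 * Real.pi * (r / (1 + r))))⁻¹) * hE

lemma mixtureRatio_nonneg (a r e : ℝ) : 0 ≤ mixtureRatio a r e := by
  unfold mixtureRatio; positivity

lemma lintegral_exp_mul_gaussianPDF (a e : ℝ) {r : ℝ} (hr : 0 < r) :
    ∫⁻ z, ENNReal.ofReal (Real.exp (z * e - z ^ 2 / 2)) *
        ProbabilityTheory.gaussianPDF a r.toNNReal z = ENNReal.ofReal (mixtureRatio a r e) := by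
  have h1 : 0 < 1 + r := by linarith
  have : ∀ z, ENNReal.ofReal (Real.exp (z * e - z ^ 2 / 2)) *
      ProbabilityTheory.gaussianPDF a r.toNNReal z = ENNReal.ofReal (mixtureRatio a r e) *
        ProbabilityTheory.gaussianPDF ((a + r * e) / (1 + r)) (r / (1 + r)).toNNReal z := by
    intro z
    rw [ProbabilityTheory.gaussianPDF, ProbabilityTheory.gaussianPDF,
      ← ENNReal.ofReal_mul (Real.exp_pos _).le, ← ENNReal.ofReal_mul (mixtureRatio_nonneg _ _ _),
      exp_mul_gaussianPDFReal a e z hr]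
  simp_rw [this]
  rw [lintegral_const_mul _ (ProbabilityTheory.measurable_gaussianPDF _ _),
    ProbabilityTheory.lintegral_gaussianPDF_eq_one _ (by simpa using div_pos hr h1), mul_one]

lemma measurable_mixtureRatio {α : Type*} {mα : MeasurableSpace α} {a r e : α → ℝ}
    (ha : Measurable a) (hr : Measurable r) (he : Measurable e) :
    Measurable fun x => mixtureRatio (a x) (r x) (e x) := by
  unfold mixtureRatio
  fun_prop

/-- For fixed `z` the factor `exp (z ξ/σ - z²/2)` has conditional mean at most 1, and the prior
density is past-measurable, so it joins the weight `h`. Tonelli then integrates over `z`. Mixing one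
measurement at a time needs only scalar Gaussians. -/
lemma CondSubGaussian.lintegral_mul_mixtureRatio_le_of_pos (hm : m ≤ mΩ)
    (hsub : CondSubGaussian P m σ ξ) (hσ : 0 < σ) (hξ : Measurable ξ) {a r : Ω → ℝ}
    (ha : Measurable[m] a) (hr : Measurable[m] r) (hr0 : ∀ ω, 0 < r ω) {h : Ω → ℝ≥0∞}
    (hh : Measurable[m] h) :
    ∫⁻ ω, h ω * ENNReal.ofReal (mixtureRatio (a ω) (r ω) (ξ ω / σ)) ∂P ≤ ∫⁻ ω, h ω ∂P := by
  have ha' : Measurable a := ha.mono hm le_rfl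
  have hr' : Measurable r := hr.mono hm le_rfl
  have hh' : Measurable h := hh.mono hm le_rfl
  have hpdf : Measurable fun p : Ω × ℝ =>
      ProbabilityTheory.gaussianPDF (a p.1) (r p.1).toNNReal p.2 :=
    ProbabilityTheory.measurable_uncurry_gaussianPDF.comp
      ((ha'.comp measurable_fst).prodMk ((hr'.comp measurable_fst).real_toNNReal.prodMk
        measurable_snd))
  have hpdf1 : ∀ ω, ∫⁻ z, ProbabilityTheory.gaussianPDF (a ω) (r ω).toNNReal z = 1 := fun ω =>
    ProbabilityTheory.lintegral_gaussianPDF_eq_one _ (by simpa using hr0 ω)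
  calc ∫⁻ ω, h ω * ENNReal.ofReal (mixtureRatio (a ω) (r ω) (ξ ω / σ)) ∂P
      = ∫⁻ ω, (∫⁻ z, h ω * (ENNReal.ofReal (Real.exp (z * (ξ ω / σ) - z ^ 2 / 2)) *
          ProbabilityTheory.gaussianPDF (a ω) (r ω).toNNReal z)) ∂P := by
        refine lintegral_congr fun ω => ?_
        rw [lintegral_const_mul, lintegral_exp_mul_gaussianPDF _ _ (hr0 ω)]
        exact (by fun_prop : Measurable fun z : ℝ =>
          ENNReal.ofReal (Real.exp (z * (ξ ω / σ) - z ^ 2 / 2))).mul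
          (ProbabilityTheory.measurable_gaussianPDF _ _)
    _ = ∫⁻ z, ∫⁻ ω, h ω * (ENNReal.ofReal (Real.exp (z * (ξ ω / σ) - z ^ 2 / 2)) *
          ProbabilityTheory.gaussianPDF (a ω) (r ω).toNNReal z) ∂P := by
        refine lintegral_lintegral_swap (Measurable.aemeasurable ?_)
        exact (hh'.comp measurable_fst).mul
          ((by fun_prop : Measurable fun p : Ω × ℝ =>
            ENNReal.ofReal (Real.exp (p.2 * (ξ p.1 / σ) - p.2 ^ 2 / 2))).mul hpdf)
    _ ≤ ∫⁻ z, ∫⁻ ω, h ω * ProbabilityTheory.gaussianPDF (a ω) (r ω).toNNReal z ∂P := by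
        refine lintegral_mono fun z => ?_
        have hmeas : Measurable[m] fun ω =>
            h ω * ProbabilityTheory.gaussianPDF (a ω) (r ω).toNNReal z
              * ENNReal.ofReal (Real.exp (-(z ^ 2 / 2))) := by
          refine (hh.mul ?_).mul_const _
          exact ProbabilityTheory.measurable_uncurry_gaussianPDF.comp
            (ha.prodMk (hr.real_toNNReal.prodMk measurable_const))
        have := hsub.lintegral_mul_exp_le hm hξ (z / σ) hmeas
        refine le_of_eq_of_le (lintegral_congr fun ω => ?_)
          (this.trans_eq (lintegral_congr fun ω => ?_))
        · have : Real.exp (z * (ξ ω / σ) - z ^ 2 / 2)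
              = Real.exp (-(z ^ 2 / 2)) * Real.exp (z / σ * ξ ω) := by
            rw [← Real.exp_add]
            congr 1
            ring
          rw [this, ENNReal.ofReal_mul (Real.exp_pos _).le]
          ring
        · rw [mul_assoc (h ω * _), ← ENNReal.ofReal_mul (Real.exp_pos _).le, ← Real.exp_add]
          have : -(z ^ 2 / 2) + (z / σ) ^ 2 * σ ^ 2 / 2 = 0 := by
            field_simp
            ring
          rw [this]
          simp
    _ = ∫⁻ ω, (∫⁻ z, h ω * ProbabilityTheory.gaussianPDF (a ω) (r ω).toNNReal z) ∂P := by
        refine (lintegral_lintegral_swap (Measurable.aemeasurable ?_)).symm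
        exact (hh'.comp measurable_fst).mul hpdf
    _ = ∫⁻ ω, h ω ∂P := by
        refine lintegral_congr fun ω => ?_
        rw [lintegral_const_mul _ (ProbabilityTheory.measurable_gaussianPDF _ _), hpdf1, mul_one]

/-- A vanishing posterior variance leaves no prior density. Raise `r` by `1/(n+1)` and pass to the
limit by Fatou; finiteness of `h` makes the product converge. -/
lemma CondSubGaussian.lintegral_mul_mixtureRatio_le (hm : m ≤ mΩ)
    (hsub : CondSubGaussian P m σ ξ) (hσ : 0 < σ) (hξ : Measurable ξ) {a r : Ω → ℝ}
    (ha : Measurable[m] a) (hr : Measurable[m] r) (hr0 : ∀ ω, 0 ≤ r ω) {h : Ω → ℝ≥0∞}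
    (hh : Measurable[m] h) (hh_top : ∀ ω, h ω ≠ ∞) :
    ∫⁻ ω, h ω * ENNReal.ofReal (mixtureRatio (a ω) (r ω) (ξ ω / σ)) ∂P ≤ ∫⁻ ω, h ω ∂P := by
  let ρ : ℕ → ℝ := fun n => 1 / ((n : ℝ) + 1)
  have hρ : Filter.Tendsto ρ Filter.atTop (𝓝 0) := tendsto_one_div_add_atTop_nhds_zero_nat
  have hρ0 : ∀ n, 0 < ρ n := fun n => Nat.one_div_pos_of_nat
  have hlim : ∀ ω, Filter.Tendsto
      (fun n => h ω * ENNReal.ofReal (mixtureRatio (a ω) (r ω + ρ n) (ξ ω / σ))) Filter.atTop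
      (𝓝 (h ω * ENNReal.ofReal (mixtureRatio (a ω) (r ω) (ξ ω / σ)))) := by
    intro ω
    refine ENNReal.Tendsto.const_mul (ENNReal.tendsto_ofReal ?_) (Or.inr (hh_top ω))
    have hc : ContinuousAt (fun s => mixtureRatio (a ω) s (ξ ω / σ)) (r ω) := by
      have h1 : 0 < 1 + r ω := by linarith [hr0 ω]
      unfold mixtureRatio
      have h2 : √(1 + r ω) ≠ 0 := (Real.sqrt_pos.2 h1).ne'
      have h3 := h1.ne'
      fun_prop (disch := assumption)
    refine hc.tendsto.comp ?_
    simpa using (tendsto_const_nhds (x := r ω)).add hρ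
  calc _ = ∫⁻ ω, Filter.liminf (fun n =>
          h ω * ENNReal.ofReal (mixtureRatio (a ω) (r ω + ρ n) (ξ ω / σ))) Filter.atTop ∂P :=
        lintegral_congr fun ω => (hlim ω).liminf_eq.symm
    _ ≤ Filter.liminf (fun n => ∫⁻ ω,
          h ω * ENNReal.ofReal (mixtureRatio (a ω) (r ω + ρ n) (ξ ω / σ)) ∂P) Filter.atTop := by
        refine lintegral_liminf_le fun n => (hh.mono hm le_rfl).mul ?_
        exact (measurable_mixtureRatio (ha.mono hm le_rfl)
          ((hr.mono hm le_rfl).add_const _) (hξ.div_const σ)).ennreal_ofReal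
    _ ≤ Filter.liminf (fun _ : ℕ => ∫⁻ ω, h ω ∂P) Filter.atTop := by
        refine Filter.liminf_le_liminf (Filter.Eventually.of_forall fun n => ?_)
        exact hsub.lintegral_mul_mixtureRatio_le_of_pos hm hσ hξ ha (hr.add_const _)
          (fun ω => add_pos_of_nonneg_of_pos (hr0 ω) (hρ0 n)) hh
    _ = _ := by simp

end Mixture

/-! ### Measurability of the regression quantities. -/

section Measurability

variable {α X ι : Type*} {mα : MeasurableSpace α} [MeasurableSpace X] [Fintype ι] [DecidableEq ι]
  {k : X → X → ℝ} {v : ℝ} {x : α → ι → X} {y : α → ι → ℝ} {p : α → X}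

lemma measurable_det {A : α → Matrix ι ι ℝ} (hA : ∀ i j, Measurable fun a => A a i j) :
    Measurable fun a => (A a).det := by
  simp only [Matrix.det_apply]
  exact Finset.measurable_fun_sum _ fun s _ =>
    (Finset.measurable_fun_prod _ fun i _ => hA _ _).const_smul _

lemma measurable_inv_apply {A : α → Matrix ι ι ℝ} (hA : ∀ i j, Measurable fun a => A a i j)
    (i j : ι) : Measurable fun a => (A a)⁻¹ i j := by
  simp only [Matrix.inv_def, Matrix.smul_apply, Matrix.adjugate_apply, smul_eq_mul,
    Ring.inverse_eq_inv']
  refine (measurable_det hA).inv.mul (measurable_det fun r s => ?_)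
  simp only [Matrix.updateRow_apply]
  split_ifs
  · exact measurable_const
  · exact hA r s

lemma measurable_dotProduct_inv_mulVec {A : α → Matrix ι ι ℝ}
    (hA : ∀ i j, Measurable fun a => A a i j) {u z : α → ι → ℝ}
    (hu : ∀ i, Measurable fun a => u a i) (hz : ∀ i, Measurable fun a => z a i) :
    Measurable fun a => u a ⬝ᵥ ((A a)⁻¹ *ᵥ z a) := by
  simp only [Matrix.mulVec, dotProduct]
  exact Finset.measurable_fun_sum _ fun i _ => (hu i).mul <|
    Finset.measurable_fun_sum _ fun j _ => (measurable_inv_apply hA i j).mul (hz j)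

lemma measurable_kernel (hk : Measurable fun p : X × X => k p.1 p.2) {a b : α → X}
    (ha : Measurable a) (hb : Measurable b) : Measurable fun c => k (a c) (b c) :=
  hk.comp (ha.prodMk hb)

lemma measurable_regMatrix (hk : Measurable fun p : X × X => k p.1 p.2)
    (hx : ∀ i, Measurable fun a => x a i) (i j : ι) :
    Measurable fun a => regMatrix k v (x a) i j :=
  (measurable_kernel hk (hx i) (hx j)).add_const _

lemma measurable_dataEnergy (hk : Measurable fun p : X × X => k p.1 p.2)
    (hx : ∀ i, Measurable fun a => x a i) (hy : ∀ i, Measurable fun a => y a i) :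
    Measurable fun a => dataEnergy k v (x a) (y a) :=
  measurable_dotProduct_inv_mulVec (measurable_regMatrix hk hx) hy hy

lemma measurable_postMean (hk : Measurable fun p : X × X => k p.1 p.2)
    (hx : ∀ i, Measurable fun a => x a i) (hy : ∀ i, Measurable fun a => y a i)
    (hp : Measurable p) : Measurable fun a => postMean k v (x a) (y a) (p a) :=
  measurable_dotProduct_inv_mulVec (measurable_regMatrix hk hx)
    (fun i => measurable_kernel hk hp (hx i)) hy

lemma measurable_postVar (hk : Measurable fun p : X × X => k p.1 p.2)
    (hx : ∀ i, Measurable fun a => x a i) (hp : Measurable p) :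
    Measurable fun a => postVar k v (x a) (p a) :=
  (measurable_kernel hk hp hp).sub <| measurable_dotProduct_inv_mulVec (measurable_regMatrix hk hx)
    (fun i => measurable_kernel hk hp (hx i)) (fun i => measurable_kernel hk hp (hx i))

lemma measurable_mutualInfo (hk : Measurable fun p : X × X => k p.1 p.2)
    (hx : ∀ i, Measurable fun a => x a i) : Measurable fun a => mutualInfo k v (x a) := by
  refine (Real.measurable_log.comp (measurable_det fun i j => ?_)).const_mul _
  exact ((measurable_kernel hk (hx i) (hx j)).const_smul v⁻¹).const_add _

end Measurability

/-! ### Time-uniform self-normalized concentration. -/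

section SelfNormalized

/-- The self-normalized likelihood ratio of a noise vector `e` at the points `x`. -/
noncomputable def noiseRatio {X ι : Type*} [Fintype ι] [DecidableEq ι] (k : X → X → ℝ) (v : ℝ)
    (x : ι → X) (e : ι → ℝ) : ℝ :=
  Real.exp ((v⁻¹ * (e ⬝ᵥ e) - dataEnergy k v x e) / 2 - mutualInfo k v x)

variable {X ι κ : Type*} [Fintype ι] [DecidableEq ι] [Fintype κ] [DecidableEq κ]
  {H : Type*} [NormedAddCommGroup H] [InnerProductSpace ℝ H] {Φ : X → H} {k : X → X → ℝ} {σ : ℝ}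

lemma noiseRatio_comp_equiv (k : X → X → ℝ) (v : ℝ) (x : ι → X) (e : ι → ℝ) (g : κ ≃ ι) :
    noiseRatio k v (x ∘ g) (e ∘ g) = noiseRatio k v x e := by
  rw [noiseRatio, dataEnergy_comp_equiv, mutualInfo_comp_equiv, comp_equiv_dotProduct_comp_equiv,
    noiseRatio]

lemma noiseRatio_of_isEmpty [IsEmpty ι] (k : X → X → ℝ) (v : ℝ) (x : ι → X) (e : ι → ℝ) :
    noiseRatio k v x e = 1 := by
  simp [noiseRatio, dataEnergy, mutualInfo_of_isEmpty]

/-- The prior of the new step is the Gaussian process prediction of the noise itself, in units of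
`σ`; the energy and information updates supply its exponent and root factor. -/
lemma noiseRatio_extend (hk : ∀ a b, k a b = ⟪Φ a, Φ b⟫) (hσ : 0 < σ) (x : ι → X) (p : X)
    (e : ι → ℝ) (z : ℝ) :
    noiseRatio k (σ ^ 2) (Sum.elim x fun _ : Unit => p) (Sum.elim e fun _ => z) =
      noiseRatio k (σ ^ 2) x e * mixtureRatio (postMean k (σ ^ 2) x e p / σ)
        (postVar k (σ ^ 2) x p / σ ^ 2) (z / σ) := by
  have hv : 0 < σ ^ 2 := by positivity
  have h0 := postVar_nonneg hk hv x p
  set s := postVar k (σ ^ 2) x p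
  set a := postMean k (σ ^ 2) x e p
  have h1 : 0 < 1 + s / σ ^ 2 := by positivity
  have hroot : (√(1 + s / σ ^ 2))⁻¹ = Real.exp (-(1 / 2 * Real.log (1 + s / σ ^ 2))) := by
    rw [Real.exp_neg, one_div_mul_eq_div, ← Real.log_sqrt h1.le, Real.exp_log (Real.sqrt_pos.2 h1)]
  have hz : (fun _ : Unit => z) ⬝ᵥ (fun _ => z) = z ^ 2 := by simp [dotProduct, sq]
  rw [noiseRatio, mixtureRatio, hroot, noiseRatio, ← Real.exp_add, ← Real.exp_add,
    dataEnergy_extend hk hv, mutualInfo_extend hk hv, sumElim_dotProduct_sumElim, hz,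
    ← div_eq_inv_mul s]
  congr 1
  have : (z / σ - a / σ) ^ 2 / (1 + s / σ ^ 2) = (z - a) ^ 2 / (σ ^ 2 + s) := by
    field_simp
  rw [this, div_pow]
  ring

lemma noiseRatio_succ (hk : ∀ a b, k a b = ⟪Φ a, Φ b⟫) (hσ : 0 < σ) (x : ℕ → X) (e : ℕ → ℝ)
    (t : ℕ) :
    noiseRatio k (σ ^ 2) (fun i : Fin (t + 1) => x i) (fun i => e i) =
      noiseRatio k (σ ^ 2) (fun i : Fin t => x i) (fun i => e i) *
        mixtureRatio (postMean k (σ ^ 2) (fun i : Fin t => x i) (fun i => e i) (x t) / σ)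
          (postVar k (σ ^ 2) (fun i : Fin t => x i) (x t) / σ ^ 2) (e t / σ) := by
  rw [← noiseRatio_extend hk hσ]
  let g : Fin t ⊕ Unit ≃ Fin (t + 1) :=
    ((Equiv.refl (Fin t)).sumCongr finOneEquiv.symm).trans finSumFinEquiv
  rw [← noiseRatio_comp_equiv k _ _ _ g]
  congr 1 <;> ext (a | a) <;> rfl

/-- The regression error is controlled wherever the self-normalized ratio is bounded. -/
lemma abs_sub_postMean_le_betaSqrt (hk : ∀ a b, k a b = ⟪Φ a, Φ b⟫) (hσ : 0 < σ) {B δ : ℝ}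
    (hδ0 : 0 < δ) (hδ1 : δ < 1) (x : ι → X) (p : X) (f : H) (hf : ‖f‖ ≤ B) (e : ι → ℝ)
    (he : noiseRatio k (σ ^ 2) x e ≤ Real.exp 1 / δ) :
    |⟪f, Φ p⟫ - postMean k (σ ^ 2) x (fun a => ⟪f, Φ (x a)⟫ + e a) p|
      ≤ betaSqrt B σ δ (mutualInfo k (σ ^ 2) x) * postStd k (σ ^ 2) x p := by
  have hv : 0 < σ ^ 2 := by positivity
  have hI := mutualInfo_nonneg hk hv x
  have hlog : 0 < Real.log (1 / δ) := Real.log_pos ((one_lt_div hδ0).2 hδ1)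
  -- The logarithm of `exp 1 / δ` produces the summand `1 + log (1/δ)` in `betaSqrt`.
  have h1 : (((σ ^ 2)⁻¹ * (e ⬝ᵥ e) - dataEnergy k (σ ^ 2) x e) / 2 - mutualInfo k (σ ^ 2) x)
      ≤ 1 + Real.log (1 / δ) := by
    have h2 := Real.log_le_log (Real.exp_pos _) he
    rwa [Real.log_exp, div_eq_mul_one_div (Real.exp 1) δ,
      Real.log_mul (Real.exp_pos 1).ne' (by positivity), Real.log_exp] at h2
  refine (abs_sub_postMean_le hk hv x p f e
    (C := √2 * √(mutualInfo k (σ ^ 2) x + 1 + Real.log (1 / δ))) ?_ (by positivity)).trans ?_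
  · rw [mul_pow, Real.sq_sqrt zero_le_two, Real.sq_sqrt (by positivity)]
    linarith
  · refine mul_le_mul_of_nonneg_right ?_ (Real.sqrt_nonneg _)
    unfold betaSqrt
    gcongr
    -- The mixture bound yields the factor `√2`; the maximum in `betaSqrt` can only enlarge it.
    exact le_max_right _ _

variable {Ω : Type*} {mΩ : MeasurableSpace Ω} {P : Measure Ω} [IsProbabilityMeasure P]
  [MeasurableSpace X]

lemma measurable_noiseRatio {α : Type*} {mα : MeasurableSpace α} {v : ℝ} {x : α → ι → X}
    {e : α → ι → ℝ} (hk : Measurable fun p : X × X => k p.1 p.2)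
    (hx : ∀ i, Measurable fun a => x a i) (he : ∀ i, Measurable fun a => e a i) :
    Measurable fun a => noiseRatio k v (x a) (e a) := by
  have h1 := measurable_dataEnergy (v := v) hk hx he
  have h2 := measurable_mutualInfo (v := v) hk hx
  have h3 : Measurable fun a => e a ⬝ᵥ e a := by
    simp only [dotProduct]
    exact Finset.measurable_fun_sum _ fun i _ => (he i).mul (he i)
  unfold noiseRatio
  fun_prop

/-- Time-uniform self-normalized concentration for predictable sampling points. -/
lemma measure_exists_noiseRatio_ge (hk : ∀ a b, k a b = ⟪Φ a, Φ b⟫)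
    (hk_meas : Measurable fun p : X × X => k p.1 p.2) (hσ : 0 < σ) (ℱ : Filtration ℕ mΩ)
    {x : ℕ → Ω → X} {e : ℕ → Ω → ℝ} (hx : ∀ t, Measurable[ℱ t] (x t))
    (he : ∀ t, Measurable[ℱ (t + 1)] (e t)) (hsub : ∀ t, CondSubGaussian P (ℱ t) σ (e t))
    (c : ℝ≥0∞) :
    c * P {ω | ∃ t, c ≤ ENNReal.ofReal
      (noiseRatio k (σ ^ 2) (fun i : Fin t => x i ω) (fun i => e i ω))} ≤ 1 := by
  have hv : 0 < σ ^ 2 := by positivity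
  have hx' : ∀ t (i : Fin t), Measurable[ℱ t] (x i) := fun t i =>
    (hx i).mono (ℱ.mono i.2.le) le_rfl
  have he' : ∀ t (i : Fin t), Measurable[ℱ t] (e i) := fun t i =>
    (he i).mono (ℱ.mono i.2) le_rfl
  have hM : ∀ t, Measurable[ℱ t] fun ω => ENNReal.ofReal
      (noiseRatio k (σ ^ 2) (fun i : Fin t => x i ω) (fun i => e i ω)) := fun t =>
    (measurable_noiseRatio hk_meas (hx' t) (he' t)).ennreal_ofReal
  refine (mul_measure_exists_le_of_supermartingale ℱ hM (P := P) (fun t A hA => ?_) c).trans ?_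
  -- The past event `A` is absorbed into the weight as an indicator.
  · rw [← lintegral_indicator (ℱ.le t A hA), ← lintegral_indicator (ℱ.le t A hA)]
    refine le_of_eq_of_le (lintegral_congr fun ω => ?_)
      ((hsub t).lintegral_mul_mixtureRatio_le (ℱ.le t) hσ ((he t).mono (ℱ.le _) le_rfl)
        ((measurable_postMean (v := σ ^ 2) hk_meas (hx' t) (he' t) (hx t)).div_const σ)
        ((measurable_postVar hk_meas (hx' t) (hx t)).div_const (σ ^ 2))
        (fun ω => div_nonneg (postVar_nonneg hk hv _ _) hv.le)
        ((hM t).indicator hA) (fun ω => ?_))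
    · by_cases hω : ω ∈ A
      · rw [Set.indicator_of_mem hω, Set.indicator_of_mem hω,
          noiseRatio_succ hk hσ (fun i => x i ω) (fun i => e i ω),
          ENNReal.ofReal_mul (show 0 ≤ noiseRatio k (σ ^ 2) _ _ from (Real.exp_pos _).le)]
      · simp [Set.indicator_of_notMem hω]
    · by_cases hω : ω ∈ A
      · rw [Set.indicator_of_mem hω]
        exact ENNReal.ofReal_ne_top
      · simp [Set.indicator_of_notMem hω]
  · simp [noiseRatio_of_isEmpty]

end SelfNormalized

/-! ### From rounds of `q` measurements to a single time index. -/

section Flatten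

/-- The sequence obtained by running through the rounds of a family one after the other. -/
def flatten {α : Type*} {q : ℕ} (hq : 0 < q) (z : ℕ → Fin q → α) (t : ℕ) : α :=
  z (t / q) ⟨t % q, Nat.mod_lt t hq⟩

lemma flatten_comp_finProdFinEquiv {α : Type*} {q : ℕ} (hq : 0 < q) (z : ℕ → Fin q → α) (n : ℕ) :
    (fun i : Fin (n * q) => flatten hq z i) ∘ finProdFinEquiv
      = fun a : Fin n × Fin q => z a.1 a.2 := by
  ext ⟨a, b⟩
  have h1 : (b + q * a : ℕ) / q = a := by
    rw [Nat.add_mul_div_left _ _ hq, Nat.div_eq_of_lt b.2, zero_add]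
  have h2 : (b + q * a : ℕ) % q = b := by
    rw [Nat.add_mul_mod_self_left, Nat.mod_eq_of_lt b.2]
  simp [flatten, h1, h2]

end Flatten

/-- Supplies the feature map `Φ p = kerFun p 1` required by the regression lemmas. -/
lemma kern_eq_inner (H : Type*) {X : Type*} [NormedAddCommGroup H] [InnerProductSpace ℝ H]
    [CompleteSpace H] [RKHS ℝ H X ℝ] (a b : X) :
    kern H a b = ⟪RKHS.kerFun H a (1 : ℝ), RKHS.kerFun H b (1 : ℝ)⟫ := by
  rw [RKHS.kerFun_inner, RKHS.kerFun_apply]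
  simp [kern]

/-- Every parse tree has a leaf; this licenses division with remainder by `q`. -/
lemma Spec.pos {q : ℕ} (φ : Spec q) : 0 < q := by
  induction φ with
  | pred i => exact i.pos
  | negPred i => exact i.pos
  | conj _ _ h _ => exact h
  | disj _ _ h _ => exact h

end ActiveTesting

/-! ### The good event and the main theorem. -/

theorem mainTheorem3
    {Ω : Type*} [mΩ : MeasurableSpace Ω] (P : Measure Ω) [IsProbabilityMeasure P]
    {W : Type*} [MeasurableSpace W] {q : ℕ} (φ : ActiveTesting.Spec q)
    -- the RKHS of the joint kernel on extended inputs `(environment, predicate index)`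
    {H : Type*} [NormedAddCommGroup H] [InnerProductSpace ℝ H] [CompleteSpace H]
    [RKHS ℝ H (W × Fin q) ℝ]
    (hk_meas : Measurable fun p : (W × Fin q) × (W × Fin q) => ActiveTesting.kern H p.1 p.2)
    (hk_le : ∀ p : W × Fin q, ActiveTesting.kern H p p ≤ 1)
    -- the predicates `μ i e = f (e, i)`
    (f : H) (B : ℝ) (hf : ‖f‖ ≤ B)
    (σ : ℝ) (hσ : 0 < σ) (δ : ℝ) (hδ0 : 0 < δ) (hδ1 : δ < 1) (ε : ℝ) (hε : 0 < ε)
    -- `w n` is the environment of the `(n+1)`-st round, in which the `q` predicates are measured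
    -- one after the other; `ℱ t` is the information available after `t` measurements
    (ℱ : Filtration ℕ mΩ) (w : ℕ → Ω → W) (η y : ℕ → Fin q → Ω → ℝ)
    (hw : ∀ n, Measurable[ℱ (n * q)] (w n))
    (hη : ∀ n (i : Fin q), Measurable[ℱ (n * q + (i : ℕ) + 1)] (η n i))
    (hsub : ∀ n (i : Fin q),
      ActiveTesting.CondSubGaussian P (ℱ (n * q + (i : ℕ))) σ (η n i))
    (hy : ∀ n i ω, y n i ω = f (w n ω, i) + η n i ω)
    (hsel : ∀ n ω, IsMinOn
      (ActiveTesting.acquisition φ (ActiveTesting.kern H) B σ δ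
        (fun j => w j ω) (fun j i => y j i ω) n) Set.univ (w n ω)) :
    ∃ E : Set Ω, MeasurableSet E ∧ 1 - δ < P.real E ∧
      ∀ ω ∈ E, ∀ nStar : ℕ, 1 ≤ nStar →
        8 / Real.log (1 + σ⁻¹ ^ 2)
            * ActiveTesting.roundBetaSqrt (ActiveTesting.kern H) B σ δ
                (fun j => w j ω) (nStar - 1) ^ 2
            * ActiveTesting.infoCapacity (ActiveTesting.kern H) (σ ^ 2) (q * nStar)
          ≤ ε ^ 2 * nStar →
        ∀ n ≥ nStar, ∀ wHat : W,
          ActiveTesting.IsBestSample (fun e => φ.value fun i => f (e, i))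
            (fun j => w j ω) n wHat →
          ε < φ.value (fun i => f (wHat, i)) →
          (∀ wStar : W, IsMinOn (fun e => φ.value fun i => f (e, i)) Set.univ wStar →
              0 < φ.value fun i => f (wStar, i)) ∧
            ∀ e : W, 0 < φ.value fun i => f (e, i) := by
  have hq := φ.pos
  have hv : 0 < σ ^ 2 := by positivity
  have hk := ActiveTesting.kern_eq_inner H (X := W × Fin q)
  set k := ActiveTesting.kern H (X := W × Fin q)
  let x : ℕ → Ω → W × Fin q := fun t ω => ActiveTesting.flatten hq (fun n i => (w n ω, i)) t
  let e : ℕ → Ω → ℝ := fun t ω => ActiveTesting.flatten hq (fun n i => η n i ω) t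
  -- Measurement `t` belongs to round `t / q`, whose environment is already known at time `t / q * q
  -- ≤ t`.
  have hx : ∀ t, Measurable[ℱ t] (x t) := fun t =>
    ((hw (t / q)).mono (ℱ.mono (Nat.div_mul_le_self t q)) le_rfl).prodMk measurable_const
  have ht : ∀ t, t / q * q + t % q = t := fun t => Nat.div_add_mod' t q
  have he : ∀ t, Measurable[ℱ (t + 1)] (e t) := fun t => by
    have h := hη (t / q) ⟨t % q, Nat.mod_lt t hq⟩
    rwa [ht] at h
  have hs : ∀ t, ActiveTesting.CondSubGaussian P (ℱ t) σ (e t) := fun t => by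
    have h := hsub (t / q) ⟨t % q, Nat.mod_lt t hq⟩
    rwa [ht] at h
  let M : ℕ → Ω → ℝ := fun t ω =>
    ActiveTesting.noiseRatio k (σ ^ 2) (fun i : Fin t => x i ω) (fun i => e i ω)
  have hM : ∀ t, Measurable (M t) := fun t =>
    ActiveTesting.measurable_noiseRatio hk_meas
      (fun i => (hx i).mono (ℱ.le _) le_rfl) (fun i => (he i).mono (ℱ.le _) le_rfl)
  have hc : 0 < Real.exp 1 / δ := by positivity
  -- One failure event for all times, so `nStar`, `n` and `wHat` may depend on the outcome.
  let F : Set Ω := {ω | ∃ t, ENNReal.ofReal (Real.exp 1 / δ) ≤ ENNReal.ofReal (M t ω)}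
  have hF : MeasurableSet F := by
    have : F = ⋃ t, {ω | ENNReal.ofReal (Real.exp 1 / δ) ≤ ENNReal.ofReal (M t ω)} := by
      ext; simp [F]
    rw [this]
    exact MeasurableSet.iUnion fun t => measurableSet_le measurable_const (hM t).ennreal_ofReal
  have hPF : P.real F < δ := by
    have h := ActiveTesting.measure_exists_noiseRatio_ge hk hk_meas hσ ℱ hx he hs
      (ENNReal.ofReal (Real.exp 1 / δ))
    have h' : Real.exp 1 / δ * P.real F ≤ 1 := by
      have := ENNReal.toReal_mono ENNReal.one_ne_top h
      rwa [ENNReal.toReal_mul, ENNReal.toReal_ofReal hc.le, ENNReal.toReal_one] at this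
    rw [div_mul_eq_mul_div, div_le_one hδ0] at h'
    have h1 : 1 < Real.exp 1 := Real.one_lt_exp_iff.2 one_pos
    -- Strictness comes from `exp 1 > 1` when `F` has positive probability, and from `δ > 0`
    -- otherwise.
    rcases (measureReal_nonneg (μ := P) (s := F)).eq_or_lt with h0 | h0
    · rwa [← h0]
    · nlinarith
  refine ⟨Fᶜ, hF.compl, ?_, ?_⟩
  · rw [probReal_compl_eq_one_sub hF]
    linarith
  intro ω hω nStar hN hbudget n hn wHat hbest hpos
  have hfΦ : ∀ p, f p = inner ℝ f (RKHS.kerFun H p (1 : ℝ)) := fun p => by simp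
  have hconf : ∀ n a i, |f (a, i) - ActiveTesting.postMean k (σ ^ 2)
      (ActiveTesting.inputs (fun j => w j ω) n)
      (ActiveTesting.outputs (fun j i => y j i ω) n) (a, i)|
      ≤ ActiveTesting.roundBetaSqrt k B σ δ (fun j => w j ω) n *
        ActiveTesting.postStd k (σ ^ 2) (ActiveTesting.inputs (fun j => w j ω) n) (a, i) := by
    intro n a i
    have hM' : ActiveTesting.noiseRatio k (σ ^ 2) (ActiveTesting.inputs (q := q) (fun j => w j ω) n)
        (fun b => η b.1 b.2 ω) ≤ Real.exp 1 / δ := by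
      have h : M (n * q) ω ≤ Real.exp 1 / δ := by
        by_contra! hcon
        exact hω ⟨n * q, ENNReal.ofReal_le_ofReal hcon.le⟩
      have h1 := ActiveTesting.noiseRatio_comp_equiv k (σ ^ 2)
        (fun i : Fin (n * q) => x i ω) (fun i => e i ω) finProdFinEquiv
      rw [ActiveTesting.flatten_comp_finProdFinEquiv hq (fun n i => (w n ω, i)),
        ActiveTesting.flatten_comp_finProdFinEquiv hq (fun n i => η n i ω)] at h1
      exact h1.trans_le h
    have h := ActiveTesting.abs_sub_postMean_le_betaSqrt hk hσ hδ0 hδ1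
      (ActiveTesting.inputs (q := q) (fun j => w j ω) n) (a, i) f hf _ hM'
    have hout : ActiveTesting.outputs (fun j i => y j i ω) n = fun b =>
        inner ℝ f (RKHS.kerFun H (ActiveTesting.inputs (q := q) (fun j => w j ω) n b) (1 : ℝ))
          + η b.1 b.2 ω := by
      ext b
      rw [← hfΦ]
      exact hy b.1 b.2 ω
    rw [hout, hfΦ]
    exact h
  have hall := ActiveTesting.value_pos_of_confidence φ hk hk_le hσ hε f (fun j => w j ω)
    (fun j i => y j i ω) hconf (fun n => hsel n ω) hN hbudget hn hbest hpos
  exact ⟨fun wStar _ => hall wStar, hall⟩
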